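/- All rings are commutative with unity. For a ring $A$, let $\mathrm{Jac}(A)$ be its Jacobson radical, $Z(A)=\{a\in A : ab=0 \text{ for some } 0\neq b\in A\}$ its set of zero-divisors and $\mathrm{Reg}(A)=A\setminus Z(A)$ its set of regular elements. An ideal is called regular if it contains a regular element, and $A$ is called a Prüfer ring if every nonzero finitely generated regular ideal of $A$ is projective. For a ring homomorphism $f:R\to S$ and an ideal $J$ of $S$, let $$R\bowtie^f J:=\{(r,f(r)+j)\mid r\in R,\ j\in J\},$$ a subring of $R\times S$. We say that $R\bowtie^f J$ has condition $\star$ if $$Z(R\bowtie^f J)=\{(r,f(r)+j)\mid r\in Z(R),\ j\in J\}\cup\{(r,f(r)+j)\mid r\in R,\ j\in J,\ j'(f(r)+j)=0\text{ for some } j'\in J\setminus\{0\}\}.$$ Let $R$ be a local ring (that is, a ring with exactly one maximal ideal, not necessarily Noetherian), $S$ a ring, $f:R\to S$ a ring homomorphism, and $J$ an ideal of $S$. Assume that $J\subseteq\mathrm{Jac}(S)$ and $f(\mathrm{Reg}(R))\subseteq\mathrm{Reg}(S)$. (1) If $R\bowtie^f J$ is a Prüfer ring, then $R$ is a Prüfer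 ring and $J=f(r)J$ for every $r\in\mathrm{Reg}(R)$. (2) Assume further that $R\bowtie^f J$ has condition $\star$. If $R$ is a Prüfer ring and $J=f(r)J$ for every $r\in\mathrm{Reg}(R)$, then $R\bowtie^f J$ is a Prüfer ring. -/

import Mathlib

/-- The set `Z(A)` of zero-divisors of `A` (so `0 ∈ Z(A)` when `A` is nontrivial). The set `Reg(A)`
of regular elements is Mathlib's `nonZeroDivisors A`. -/
def zeroDivisorSet (A : Type*) [CommRing A] : Set A :=
  {a | ∃ b : A, b ≠ 0 ∧ a * b = 0}

/-- An ideal is regular if it contains a regular element. -/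
def IsRegularIdeal {A : Type*} [CommRing A] (I : Ideal A) : Prop :=
  ∃ a ∈ I, a ∈ nonZeroDivisors A

/-- A Prüfer ring: every nonzero finitely generated regular ideal is projective. -/
def IsPruferRing (A : Type*) [CommRing A] : Prop :=
  ∀ I : Ideal A, I ≠ ⊥ → I.FG → IsRegularIdeal I → Module.Projective A I

/-- The amalgamation `R ⋈^f J = {(r, f r + j) | r ∈ R, j ∈ J}`, as a subring of `R × S`. -/
def amalgamation {R S : Type*} [CommRing R] [CommRing S] (f : R →+* S) (J : Ideal S) :
    Subring (R × S) where
  carrier := {p | ∃ r : R, ∃ j ∈ J, p = (r, f r + j)}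
  mul_mem' := by
    rintro _ _ ⟨r, j, hj, rfl⟩ ⟨s, k, hk, rfl⟩
    refine ⟨r * s, f r * k + j * f s + j * k, ?_, ?_⟩
    · exact J.add_mem (J.add_mem (J.mul_mem_left _ hk) (J.mul_mem_right _ hj))
        (J.mul_mem_left _ hk)
    · ext
      · rfl
      · simp only [Prod.snd_mul, map_mul]
        ring
  one_mem' := ⟨1, 0, J.zero_mem, by ext <;> simp⟩
  add_mem' := by
    rintro _ _ ⟨r, j, hj, rfl⟩ ⟨s, k, hk, rfl⟩
    refine ⟨r + s, j + k, J.add_mem hj hk, ?_⟩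
    ext
    · rfl
    · simp only [Prod.snd_add, map_add]
      ring
  zero_mem' := ⟨0, 0, J.zero_mem, by ext <;> simp⟩
  neg_mem' := by
    rintro _ ⟨r, j, hj, rfl⟩
    refine ⟨-r, -j, J.neg_mem hj, ?_⟩
    ext
    · rfl
    · simp only [Prod.snd_neg, map_neg]
      ring

/-- The condition `⋆` for `R ⋈^f J`: its zero-divisors are exactly the elements `(r, f r + j)`
(`r ∈ R`, `j ∈ J`) such that `r ∈ Z(R)` or `j' (f r + j) = 0` for some nonzero `j' ∈ J`. -/
def AmalgamationStar {R S : Type*} [CommRing R] [CommRing S] (f : R →+* S) (J : Ideal S) : Prop :=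
  zeroDivisorSet (amalgamation f J) =
    {x : amalgamation f J |
      ∃ r : R, ∃ j ∈ J, (x : R × S) = (r, f r + j) ∧ r ∈ zeroDivisorSet R} ∪
    {x : amalgamation f J |
      ∃ r : R, ∃ j ∈ J, (x : R × S) = (r, f r + j) ∧ ∃ j' ∈ J, j' ≠ 0 ∧ j' * (f r + j) = 0}

/-! Over a local ring a finitely generated projective ideal is free of rank at most one, hence
principal, so being Prüfer becomes a statement about divisibility (`isPruferRing_iff_dvd_or_dvd`).
Since `J` lies in the Jacobson radical, the amalgamation is local too. For (1), compare `(r, f r)`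
with `(s, f s)` and with `(0, j)`. For (2), `⋆` makes the first coordinate of a regular element
regular, and `J = f(r)J` makes `(r, f r + j)` an associate of `(r, f r)`, so divisibility is decided
in `R`. -/

theorem mem_nonZeroDivisors_of_dvd {A : Type*} [CommRing A] {a b : A}
    (ha : a ∈ nonZeroDivisors A) (h : b ∣ a) : b ∈ nonZeroDivisors A := by
  obtain ⟨c, rfl⟩ := h
  exact (mul_mem_nonZeroDivisors.mp ha).1

theorem mem_nonZeroDivisors_of_notMem_zeroDivisorSet {A : Type*} [CommRing A] {a : A}
    (ha : a ∉ zeroDivisorSet A) : a ∈ nonZeroDivisors A :=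
  mem_nonZeroDivisors_iff_right.mpr fun b hb =>
    by_contra fun hb0 => ha ⟨b, hb0, by rwa [mul_comm]⟩

theorem notMem_zeroDivisorSet_of_mem_nonZeroDivisors {A : Type*} [CommRing A] {a : A}
    (ha : a ∈ nonZeroDivisors A) : a ∉ zeroDivisorSet A := by
  rintro ⟨b, hb0, hb⟩
  exact hb0 (mem_nonZeroDivisors_iff_right.mp ha b (by rwa [mul_comm]))

theorem Ideal.projective_span_singleton {A : Type*} [CommRing A] {a : A}
    (ha : a ∈ nonZeroDivisors A) : Module.Projective A (Ideal.span {a}) := by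
  have hinj : Function.Injective (LinearMap.toSpanSingleton A A a) := by
    rw [injective_iff_map_eq_zero]
    intro x hx
    exact mem_nonZeroDivisors_iff_right.mp ha x (by simpa using hx)
  exact Module.Projective.of_equiv ((LinearEquiv.ofInjective _ hinj).trans
    (LinearEquiv.ofEq _ _ (LinearMap.range_toSpanSingleton a)))

/-- A finitely generated projective ideal of a local ring is principal. -/
theorem Ideal.isPrincipal_of_projective {A : Type*} [CommRing A] [IsLocalRing A] {I : Ideal A}
    (hfg : I.FG) (hI : Module.Projective A I) : I.IsPrincipal := by
  have : Module.Finite A I := Module.Finite.iff_fg.mpr hfg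
  have : Module.Free A I := Module.free_of_flat_of_isLocalRing
  rw [← Submodule.rank_le_one_iff_isPrincipal]
  exact (Submodule.rank_le I).trans_eq (Module.rank_self A)

/-- In a local ring, one of two generators of a principal regular ideal generates it. -/
theorem dvd_or_dvd_of_span_pair_isPrincipal {A : Type*} [CommRing A] [IsLocalRing A] {a b : A}
    (ha : a ∈ nonZeroDivisors A) (h : (Ideal.span {a, b}).IsPrincipal) : a ∣ b ∨ b ∣ a := by
  obtain ⟨c, hc⟩ := h
  rw [Ideal.submodule_span_eq] at hc
  obtain ⟨a', rfl⟩ := Ideal.mem_span_singleton.mp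
    (hc ▸ Ideal.subset_span (by simp) : a ∈ Ideal.span {c})
  obtain ⟨b', rfl⟩ := Ideal.mem_span_singleton.mp
    (hc ▸ Ideal.subset_span (by simp) : b ∈ Ideal.span {c})
  obtain ⟨x, y, hxy⟩ := Ideal.mem_span_pair.mp
    (hc ▸ Ideal.mem_span_singleton_self c : c ∈ Ideal.span {c * a', c * b'})
  have hcr := mem_nonZeroDivisors_of_dvd ha (Dvd.intro _ rfl)
  have hone : x * a' + y * b' = 1 := sub_eq_zero.mp <|
    mem_nonZeroDivisors_iff_right.mp hcr _ (by linear_combination hxy)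
  -- If `a'` or `b'` is a unit, the corresponding generator is an associate of `c`.
  rcases IsLocalRing.isUnit_or_isUnit_of_add_one hone with hu | hu
  · exact .inl (mul_dvd_mul_left c (isUnit_of_mul_isUnit_right hu).dvd)
  · exact .inr (mul_dvd_mul_left c (isUnit_of_mul_isUnit_right hu).dvd)

/-- If regular elements are comparable with all elements for divisibility, then finitely generated
regular ideals are generated by a regular element. -/
theorem exists_span_insert_eq_span_singleton {A : Type*} [CommRing A]
    (h : ∀ a ∈ nonZeroDivisors A, ∀ b : A, a ∣ b ∨ b ∣ a) {a : A} (ha : a ∈ nonZeroDivisors A)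
    (s : Finset A) :
    ∃ c ∈ nonZeroDivisors A, Ideal.span (insert a (s : Set A)) = Ideal.span {c} := by
  classical
  induction s using Finset.induction_on with
  | empty => exact ⟨a, ha, by simp⟩
  | insert b s _ ih =>
    obtain ⟨c, hc, hs⟩ := ih
    rw [Finset.coe_insert, Set.insert_comm, Ideal.span_insert, hs]
    rcases h c hc b with hd | hd
    · exact ⟨c, hc, sup_eq_right.mpr (Ideal.span_singleton_le_span_singleton.mpr hd)⟩
    · exact ⟨b, mem_nonZeroDivisors_of_dvd hc hd,
        sup_eq_left.mpr (Ideal.span_singleton_le_span_singleton.mpr hd)⟩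

/-- A local ring is a Prüfer ring if and only if each regular element is comparable with every
element for divisibility. -/
theorem isPruferRing_iff_dvd_or_dvd {A : Type*} [CommRing A] [IsLocalRing A] :
    IsPruferRing A ↔ ∀ a ∈ nonZeroDivisors A, ∀ b : A, a ∣ b ∨ b ∣ a := by
  refine ⟨fun h a ha b => ?_, fun h I _ hfg hreg => ?_⟩
  · have haI : a ∈ Ideal.span {a, b} := Ideal.subset_span (by simp)
    have hfg : (Ideal.span {a, b}).FG := Submodule.fg_span (Set.toFinite _)
    refine dvd_or_dvd_of_span_pair_isPrincipal ha
      (Ideal.isPrincipal_of_projective hfg (h _ ?_ hfg ⟨a, haI, ha⟩))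
    exact fun h0 => nonZeroDivisors.ne_zero ha (by simpa [h0] using haI)
  · obtain ⟨a, haI, ha⟩ := hreg
    obtain ⟨s, rfl⟩ := hfg
    obtain ⟨c, hc, hs⟩ := exists_span_insert_eq_span_singleton h ha s
    rw [Ideal.span_insert, sup_eq_right.mpr ((Ideal.span_singleton_le_iff_mem _).mpr haI)] at hs
    exact hs ▸ Ideal.projective_span_singleton hc

section Amalgamation

variable {R S : Type*} [CommRing R] [CommRing S] (f : R →+* S) (J : Ideal S)

theorem mem_amalgamation {x : R × S} : x ∈ amalgamation f J ↔ x.2 - f x.1 ∈ J := by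
  constructor
  · rintro ⟨r, j, hj, rfl⟩
    simpa using hj
  · intro h
    exact ⟨x.1, _, h, by ext <;> simp⟩

/-- The element `(r, f r + j)` of the amalgamation. -/
def amalgamation.mk (r : R) (j : J) : amalgamation f J :=
  ⟨(r, f r + j), r, j, j.2, rfl⟩

theorem amalgamation.exists_eq_mk (x : amalgamation f J) :
    ∃ r j, x = amalgamation.mk f J r j := by
  obtain ⟨_, r, j, hj, rfl⟩ := x
  exact ⟨r, ⟨j, hj⟩, rfl⟩

/-- With `u` inverse to `r`, `f r + j = f r * (1 + j * f u)`, and the last factor is a unit because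
`j` is in the Jacobson radical. -/
theorem amalgamation.isUnit_mk (hJ : J ≤ Ideal.jacobson (⊥ : Ideal S)) {r : R} (hr : IsUnit r)
    (j : J) : IsUnit (amalgamation.mk f J r j) := by
  obtain ⟨u, hu⟩ := hr.exists_right_inv
  have hfu : f r * f u = 1 := by rw [← map_mul, hu, map_one]
  obtain ⟨v, hv⟩ :=
    (Ideal.mem_jacobson_bot.mp (hJ j.2) (f u)).exists_right_inv
  refine IsUnit.of_mul_eq_one (⟨(u, f u * v), (mem_amalgamation f J).mpr ?_⟩ : amalgamation f J)
    (Subtype.ext (Prod.ext hu ?_))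
  · have : f u * v - f u = (j : S) * (-(f u * f u * v)) := by linear_combination f u * hv
    exact this ▸ J.mul_mem_right _ j.2
  · change (f r + j) * (f u * v) = 1
    linear_combination hv + v * hfu

theorem amalgamation.isLocalRing [IsLocalRing R] (hJ : J ≤ Ideal.jacobson (⊥ : Ideal S)) :
    IsLocalRing (amalgamation f J) := by
  -- The projection to `R` reflects units, so locality lifts from `R`.
  have : IsLocalHom ((RingHom.fst R S).comp (amalgamation f J).subtype) := ⟨fun x hx => by
    obtain ⟨r, j, rfl⟩ := amalgamation.exists_eq_mk f J x
    exact amalgamation.isUnit_mk f J hJ hx j⟩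
  exact RingHom.domain_isLocalRing ((RingHom.fst R S).comp (amalgamation f J).subtype)

theorem amalgamation.mk_zero_mem_nonZeroDivisors {r : R} (hr : r ∈ nonZeroDivisors R)
    (hfr : f r ∈ nonZeroDivisors S) :
    amalgamation.mk f J r 0 ∈ nonZeroDivisors (amalgamation f J) := by
  refine mem_nonZeroDivisors_iff_right.mpr fun x hx => Subtype.ext (Prod.ext ?_ ?_)
  · exact mem_nonZeroDivisors_iff_right.mp hr _ congr(($hx : R × S).1)
  · refine mem_nonZeroDivisors_iff_right.mp hfr _ ?_
    have h : (x : R × S).2 * (f r + ((0 : J) : S)) = 0 := congr(($hx : R × S).2)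
    simpa using h

theorem amalgamation.dvd_of_mk_dvd_mk {r s : R} {j k : J}
    (h : amalgamation.mk f J r j ∣ amalgamation.mk f J s k) : r ∣ s := by
  obtain ⟨x, hx⟩ := h
  exact ⟨(x : R × S).1, congr(($hx : R × S).1)⟩

theorem amalgamation.exists_eq_mul_of_mk_zero_dvd {r : R} (hr : r ∈ nonZeroDivisors R) {j : J}
    (h : amalgamation.mk f J r 0 ∣ amalgamation.mk f J 0 j) : ∃ k ∈ J, (j : S) = f r * k := by
  obtain ⟨x, hx⟩ := h
  obtain ⟨s, k, rfl⟩ := amalgamation.exists_eq_mk f J x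
  have h1 : 0 = r * s := congr(($hx : R × S).1)
  have h2 : f 0 + (j : S) = (f r + ((0 : J) : S)) * (f s + k) := congr(($hx : R × S).2)
  -- Regularity of `r` forces the quotient into `0 × J`.
  obtain rfl : s = 0 := mem_nonZeroDivisors_iff_right.mp hr s (by rw [mul_comm, ← h1])
  exact ⟨k, k.2, by simpa using h2⟩

/-- If `J = f(r)J` lies in the Jacobson radical, the divisors of `r` give divisors in the
amalgamation. -/
theorem amalgamation.mk_dvd_mk (hJ : J ≤ Ideal.jacobson (⊥ : Ideal S)) {r s : R}
    (hJr : J = Ideal.span {f r} * J) (h : r ∣ s) (j k : J) :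
    amalgamation.mk f J r j ∣ amalgamation.mk f J s k := by
  have key : ∀ i : J, ∃ i' ∈ J, f r * i' = i := fun i =>
    Ideal.mem_span_singleton_mul.mp (hJr ▸ i.2)
  obtain ⟨j', hj', hj⟩ := key j
  obtain ⟨k', hk', hk⟩ := key k
  obtain ⟨t, rfl⟩ := h
  -- The factor `(1, 1 + j')` is a unit, so `j` may be replaced by `0`.
  have hmul : amalgamation.mk f J r 0 * amalgamation.mk f J 1 ⟨j', hj'⟩ =
      amalgamation.mk f J r j := by
    refine Subtype.ext (Prod.ext (mul_one r) ?_)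
    change (f r + ((0 : J) : S)) * (f 1 + j') = f r + j
    simp [mul_add, hj]
  rw [← hmul, (amalgamation.isUnit_mk f J hJ isUnit_one _).mul_right_dvd]
  refine ⟨amalgamation.mk f J t ⟨k', hk'⟩, Subtype.ext (Prod.ext rfl ?_)⟩
  change f (r * t) + k = (f r + ((0 : J) : S)) * (f t + k')
  simp [mul_add, hk]

theorem AmalgamationStar.mem_nonZeroDivisors {f : R →+* S} {J : Ideal S}
    (h : AmalgamationStar f J) {r : R} {j : J}
    (hx : amalgamation.mk f J r j ∈ nonZeroDivisors (amalgamation f J)) :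
    r ∈ nonZeroDivisors R := by
  refine mem_nonZeroDivisors_of_notMem_zeroDivisorSet fun hr =>
    notMem_zeroDivisorSet_of_mem_nonZeroDivisors hx ?_
  rw [h]
  exact .inl ⟨r, j, j.2, rfl, hr⟩

end Amalgamation

theorem mainTheorem11 {R S : Type*} [CommRing R] [CommRing S] [IsLocalRing R]
    (f : R →+* S) (J : Ideal S) (hJ : J ≤ Ideal.jacobson (⊥ : Ideal S))
    (hf : ∀ r ∈ nonZeroDivisors R, f r ∈ nonZeroDivisors S) :
    (IsPruferRing (amalgamation f J) →
      IsPruferRing R ∧ ∀ r ∈ nonZeroDivisors R, J = Ideal.span {f r} * J) ∧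
    (AmalgamationStar f J →
      (IsPruferRing R ∧ ∀ r ∈ nonZeroDivisors R, J = Ideal.span {f r} * J) →
      IsPruferRing (amalgamation f J)) := by
  have := amalgamation.isLocalRing f J hJ
  rw [isPruferRing_iff_dvd_or_dvd, isPruferRing_iff_dvd_or_dvd]
  refine ⟨fun h => ⟨fun r hr s => ?_, fun r hr => le_antisymm (fun j hj => ?_) Ideal.mul_le_right⟩,
    fun hstar ⟨h, hJr⟩ x hx y => ?_⟩
  · exact (h _ (amalgamation.mk_zero_mem_nonZeroDivisors f J hr (hf r hr))
      (amalgamation.mk f J s 0)).imp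
      (amalgamation.dvd_of_mk_dvd_mk f J) (amalgamation.dvd_of_mk_dvd_mk f J)
  · rcases h _ (amalgamation.mk_zero_mem_nonZeroDivisors f J hr (hf r hr))
      (amalgamation.mk f J 0 ⟨j, hj⟩) with hd | hd
    · obtain ⟨k, hk, hjk⟩ := amalgamation.exists_eq_mul_of_mk_zero_dvd f J hr hd
      exact Ideal.mem_span_singleton_mul.mpr ⟨k, hk, hjk.symm⟩
    -- The reverse divisibility would give `0 ∣ r`.
    · exact absurd (zero_dvd_iff.mp (amalgamation.dvd_of_mk_dvd_mk f J hd))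
        (nonZeroDivisors.ne_zero hr)
  · obtain ⟨r, j, rfl⟩ := amalgamation.exists_eq_mk f J x
    obtain ⟨s, k, rfl⟩ := amalgamation.exists_eq_mk f J y
    have hr := hstar.mem_nonZeroDivisors hx
    -- If `s ∣ r`, then `s` is regular as well, so `J = f(s)J`.
    exact (h r hr s).imp (fun hd => amalgamation.mk_dvd_mk f J hJ (hJr r hr) hd j k)
      fun hd => amalgamation.mk_dvd_mk f J hJ
        (hJr s (mem_nonZeroDivisors_of_dvd hr hd)) hd k j
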